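/- Let $X$ be a real Hilbert space and let $T\colon X\rightrightarrows X$ be a set-valued mapping with nonempty domain $\operatorname{dom}T=\{u: T(u)\neq\emptyset\}$ and with graph $\operatorname{gph}T=\{(u,v): v\in T(u)\}$ closed in the norm topology of $X\times X$. Let $\kappa>0$. Definitions. $T$ is *monotone* if $\langle v_1-v_2,u_1-u_2\rangle\ge 0$ for all $(u_1,v_1),(u_2,v_2)\in\operatorname{gph}T$; it is *maximal monotone* if it is monotone and $\operatorname{gph}T=\operatorname{gph}S$ for every monotone $S\colon X\rightrightarrows X$ with $\operatorname{gph}T\subset\operatorname{gph}S$; it is *strongly maximal monotone with modulus $\kappa$* if it is maximal monotone and $T-\kappa I$ is monotone, where $I$ is the identity mapping. $T$ is *hypomonotone* if there is $r>0$ such that $$\langle v_1-v_2,u_1-u_2\rangle\ge -r\|u_1-u_2\|^2\qquad(*)$$ for all $(u_1,v_1),(u_2,v_2)\in\operatorname{gph}T$; it is *semilocally hypomonotone* if for every $\bar u\in\operatorname{dom}T$ there are a neighborhood $U$ of $\bar u$ and $r>0$ such that $(*)$ holds for all $(u_1,v_1),(u_2,v_2)\in\operatorname{gph}T\cap(U\times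 X)$. For $(u,v)\in\operatorname{gph}T$ and $w\in X$, the *regular coderivative* $\widehat D^*T(u,v)(w)$ is the set of all $z\in X$ such that for every $\varepsilon>0$ there is $\delta>0$ with $$\langle z,u'-u\rangle-\langle w,v'-v\rangle\le\varepsilon\,\|(u'-u,v'-v)\|$$ for all $(u',v')\in\operatorname{gph}T$ with $\|(u'-u,v'-v)\|<\delta$, where $\|(a,b)\|=\sqrt{\|a\|^2+\|b\|^2}$. The *mixed limiting coderivative* $D_M^*T(u,v)(w)$ is the set of all $z\in X$ for which there are sequences $(u_k,v_k)\in\operatorname{gph}T$, $w_k\in X$ and $z_k\in\widehat D^*T(u_k,v_k)(w_k)$ such that $u_k\to u$, $v_k\to v$, $w_k\to w$ in norm and $z_k\to z$ weakly. Then the following assertions are equivalent: (i) $T$ is strongly maximal monotone with modulus $\kappa$. (ii) $T$ is hypomonotone and, for every $(u,v)\in\operatorname{gph}T$, $\langle z,w\rangle\ge\kappa\|w\|^2$ whenever $w\in X$ and $z\in\widehat D^*T(u,v)(w)$. (iii) $T$ is hypomonotone and, for every $(u,v)\in\operatorname{gph}T$, $\langle z,w\rangle\ge\kappa\|w\|^2$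 whenever $w\in X$ and $z\in D_M^*T(u,v)(w)$. If in addition $\operatorname{dom}T$ is convex, then the equivalence of (i), (ii) and (iii) remains true when "hypomonotone" is replaced by "semilocally hypomonotone" in (ii) and (iii). -/

import Mathlib

open Filter Topology

namespace SetValued

section NormalCone

variable {E : Type*} [NormedAddCommGroup E] [InnerProductSpace ℝ E]

/-- The regular (Fréchet) normal cone to `Ω` at `x`: the vectors `n` with
`limsup ⟪n, y - x⟫ / ‖y - x‖ ≤ 0` as `y → x`, `y ∈ Ω`, `y ≠ x`, that is, the regular
subdifferential at `x` of the indicator function of `Ω`. It is empty if `x ∉ Ω`. -/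
def regularNormalCone (Ω : Set E) (x : E) : Set E :=
  {n | x ∈ Ω ∧ ∀ ε : ℝ, 0 < ε → ∀ᶠ y in 𝓝[Ω] x, inner ℝ n (y - x) ≤ ε * ‖y - x‖}

end NormalCone

section Mappings

variable {X : Type*} [NormedAddCommGroup X] [InnerProductSpace ℝ X]

/-- The domain of a set-valued mapping. -/
def dom (T : X → Set X) : Set X := {u | (T u).Nonempty}

/-- The graph of a set-valued mapping. -/
def gph (T : X → Set X) : Set (X × X) := {p | p.2 ∈ T p.1}

/-- The mapping `T + c I`, with `I` the identity mapping. -/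
def addSmulId (T : X → Set X) (c : ℝ) : X → Set X := fun u => (fun v => v + c • u) '' T u

/-- Monotonicity on the whole space. -/
def IsMonotone (T : X → Set X) : Prop :=
  ∀ p ∈ gph T, ∀ q ∈ gph T, 0 ≤ inner ℝ (p.2 - q.2) (p.1 - q.1)

/-- Maximal monotonicity. -/
def IsMaximalMonotone (T : X → Set X) : Prop :=
  IsMonotone T ∧ ∀ S : X → Set X, IsMonotone S → gph T ⊆ gph S → gph T = gph S

/-- Strong maximal monotonicity with modulus `κ`: `T` is maximal monotone and `T - κ I` is
monotone. -/
def IsStronglyMaximalMonotone (κ : ℝ) (T : X → Set X) : Prop :=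
  IsMaximalMonotone T ∧ IsMonotone (addSmulId T (-κ))

/-- Global hypomonotonicity: `T + r I` is monotone for some `r > 0`. -/
def IsHypomonotone (T : X → Set X) : Prop :=
  ∃ r : ℝ, 0 < r ∧ ∀ p ∈ gph T, ∀ q ∈ gph T,
    -r * ‖p.1 - q.1‖ ^ 2 ≤ inner ℝ (p.2 - q.2) (p.1 - q.1)

/-- Semilocal hypomonotonicity on the whole space: near every point of the domain, the
hypomonotonicity inequality holds, with the localization only in the domain space. -/
def IsSemilocallyHypomonotone (T : X → Set X) : Prop :=
  ∀ a ∈ dom T, ∃ U ∈ 𝓝 a, ∃ r : ℝ, 0 < r ∧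
    ∀ p ∈ gph T ∩ U ×ˢ Set.univ, ∀ q ∈ gph T ∩ U ×ˢ Set.univ,
      -r * ‖p.1 - q.1‖ ^ 2 ≤ inner ℝ (p.2 - q.2) (p.1 - q.1)

/-- The regular coderivative of `T` at `(u, v)` applied to `w`: all `z` such that `(z, -w)` is
a regular normal to the graph at `(u, v)`. The product is `WithLp 2 (X × X)`, the Hilbert space
with inner product `⟪(a, b), (c, d)⟫ = ⟪a, c⟫ + ⟪b, d⟫`. -/
def regularCoderivative (T : X → Set X) (u v w : X) : Set X :=
  {z | WithLp.toLp 2 (z, -w) ∈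
    regularNormalCone (WithLp.ofLp ⁻¹' gph T : Set (WithLp 2 (X × X))) (WithLp.toLp 2 (u, v))}

/-- The mixed limiting coderivative of `T` at `(u, v)` applied to `w`: the weak sequential limits
of `z k ∈ D̂*T(u k, v k)(y k)` with `u k → u`, `v k → v` and `y k → w` in norm. -/
def mixedCoderivative (T : X → Set X) (u v w : X) : Set X :=
  {z | ∃ a b y ζ : ℕ → X,
    Tendsto a atTop (𝓝 u) ∧ Tendsto b atTop (𝓝 v) ∧ Tendsto y atTop (𝓝 w) ∧
    (∀ h : X, Tendsto (fun k => inner ℝ (ζ k) h) atTop (𝓝 (inner ℝ z h))) ∧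
    ∀ k, ζ k ∈ regularCoderivative T (a k) (b k) (y k)}

end Mappings

end SetValued

/-!
Write `J = (I + c T)⁻¹` for the resolvent of `T`. Everything is read off from the behaviour of `J`.

*The coderivative bound suffices.* If `T` is hypomonotone on a ball and `c` is small, then `J` is
single-valued and Lipschitz on a locally closed set, the range of `I + c T`. A quadratic normal `n`
to this set at `u + c v` yields `n ∈ D̂*T(u, v)(-c n)`, and `⟪n, -c n⟫ ≥ 0` gives `n = 0`. As
nonzero normals exist near any point off a closed set, `J` is defined on a whole ball
(`exists_add_smul_eq`). Likewise a quadratic subgradient `w` of `⟪p, J ·⟫` yields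
`w - p ∈ D̂*T(u, v)(-c w)`, so that `m ‖w‖² ≤ ⟪p, w⟫` with `m = 1 + κ c`, that is, `w` lies in the
ball of centre `p / (2 m)` and radius `‖p‖ / (2 m)`. Hence the subgradients of
`⟪p, J ·⟫ - ⟪p, ·⟫ / (2 m)` are bounded by `‖p‖ / (2 m)`, a mean value inequality bounds the
increments of this function, and since `p` is arbitrary, the increments of `J` satisfy
`m ‖J x - J y‖² ≤ ⟪x - y, J x - J y⟫`, which is strong monotonicity of `T` with modulus `κ`
(`IsHypomonotoneOn.neg_of_coderivativeBound`). Normals and subgradients are produced by a smooth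
variational principle (`exists_quadratic_support`), which takes the place of compactness.

If `T` is globally hypomonotone, the balls may be taken as large as needed; then `T - κ I` is
monotone and `I + c T` is onto, which makes `T` maximal. If `T` is only semilocally hypomonotone
but has a convex domain, the local inequalities add up along segments
(`isHypomonotoneOn_univ_of_local`) and the global case applies.

*The coderivative bound is necessary.* If `T` is maximal monotone, then `I + T` is onto by Minty's
theorem (`IsMaximalMonotone.exists_add_eq`), proved with the Fitzpatrick function. So the inequality
defining `z ∈ D̂*T(u, v)(w)` may be tested along `t ↦ J (u + v + t h)` for each direction `h`, which
puts `w` in the ball of centre `(z + w) / (2 m)` and radius `‖z + w‖ / (2 m)`, `m = 1 + κ`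
(`IsStronglyMaximalMonotone.hasCoderivativeBound`).

*Limiting coderivatives.* The bound passes to limits because the pairing of a weakly convergent
sequence with a norm convergent one converges (`tendsto_inner_of_weak`).
-/

namespace SetValued

/-! ### A smooth variational principle -/

section Variational

variable {E : Type*} [NormedAddCommGroup E] [InnerProductSpace ℝ E]

/-- One step of the construction behind `exists_quadratic_support`: `x` almost minimizes over `D`
the function `f - ⟪q, · - x⟫ + C ‖· - x‖²`. Adding `a ‖· - x‖²` and passing to a better
almost-minimizer `x'` moves the point little and keeps the perturbation quadratic. -/
lemma exists_next_almost_minimizer {D : Set E} {f : E → ℝ} {x q : E} {C δ a δ' : ℝ} (hx : x ∈ D)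
    (hC : 0 ≤ C) (ha : 0 < a) (hδ' : 0 < δ')
    (h : ∀ y ∈ D, f x + inner ℝ q (y - x) - C * ‖y - x‖ ^ 2 - δ ≤ f y) :
    ∃ x' q' : E, x' ∈ D ∧
      (∀ y ∈ D, f x' + inner ℝ q' (y - x') - (C + a) * ‖y - x'‖ ^ 2 - δ' ≤ f y) ∧
      a * ‖x' - x‖ ^ 2 ≤ δ ∧ ‖q' - q‖ ≤ 2 * (C + a) * ‖x' - x‖ := by
  set g : E → ℝ := fun y => f y - inner ℝ q (y - x) + (C + a) * ‖y - x‖ ^ 2 with hg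
  have hgx : g x = f x := by simp [hg]
  have hbdd : BddBelow (g '' D) := by
    refine ⟨f x - δ, ?_⟩
    rintro _ ⟨y, hy, rfl⟩
    have := h y hy
    have h2 : 0 ≤ a * ‖y - x‖ ^ 2 := by positivity
    simp only [hg]
    linarith
  have hne : (g '' D).Nonempty := ⟨g x, x, hx, rfl⟩
  obtain ⟨x', hx'D, hmin, hle⟩ : ∃ x' ∈ D, (∀ y ∈ D, g x' - δ' ≤ g y) ∧ g x' ≤ g x := by
    obtain ⟨_, ⟨y, hy, rfl⟩, hlt⟩ :=
      exists_lt_of_csInf_lt hne (lt_add_of_pos_right (sInf (g '' D)) hδ')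
    have hinf : ∀ w ∈ D, sInf (g '' D) ≤ g w := fun w hw => csInf_le hbdd ⟨w, hw, rfl⟩
    rcases le_total (g y) (g x) with hyx | hxy
    · exact ⟨y, hy, fun w hw => by linarith [hinf w hw], hyx⟩
    · exact ⟨x, hx, fun w hw => by linarith [hinf w hw], le_rfl⟩
  refine ⟨x', q - (2 * (C + a)) • (x' - x), hx'D, fun y hy => ?_, ?_, ?_⟩
  · have h1 := hmin y hy
    have e1 : y - x = (y - x') + (x' - x) := by abel
    have e2 : ‖y - x‖ ^ 2 = ‖y - x'‖ ^ 2 + 2 * inner ℝ (y - x') (x' - x) + ‖x' - x‖ ^ 2 := by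
      rw [e1, norm_add_sq_real]
    have e3 : inner ℝ q (y - x) = inner ℝ q (y - x') + inner ℝ q (x' - x) := by
      rw [e1, inner_add_right]
    simp only [hg] at h1
    rw [e2, e3] at h1
    rw [inner_sub_left, real_inner_smul_left, real_inner_comm (y - x') (x' - x)]
    linarith
  · have h1 := h x' hx'D
    rw [hgx] at hle
    simp only [hg] at hle
    linarith
  · rw [sub_sub_cancel_left, norm_neg, norm_smul, Real.norm_of_nonneg (by positivity)]

/-- A smooth variational principle in Hilbert spaces (Borwein-Preiss): a continuous function which
is bounded below on a closed set `D` has a quadratic minorant on `D`, with a small linear part, that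
touches it at a point where its value is at most slightly above a prescribed value `f a`. -/
theorem exists_quadratic_support [CompleteSpace E] {D : Set E} (hD : IsClosed D)
    {f : E → ℝ} (hf : ContinuousOn f D) {m : ℝ} (hm : ∀ y ∈ D, m ≤ f y) {a : E} (haD : a ∈ D)
    {ε : ℝ} (hε : 0 < ε) :
    ∃ x q : E, x ∈ D ∧ ‖q‖ ≤ ε ∧ f x ≤ f a + ε ∧
      ∀ y ∈ D, f x + inner ℝ q (y - x) - ‖y - x‖ ^ 2 ≤ f y := by
  obtain ⟨η, hη, hηε, hη1⟩ : ∃ η : ℝ, 0 < η ∧ 16 * η ≤ ε ∧ 16 * η ≤ 1 :=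
    ⟨min ε 1 / 16, by positivity, by linarith [min_le_left ε 1], by linarith [min_le_right ε 1]⟩
  -- With `δ k` small compared with the increment `2⁻¹ ^ (k + 1)` of `C k`, both the points and the
  -- linear parts move by at most a multiple of `η / 2 ^ k`, while `C k` stays below `1`.
  set δ : ℕ → ℝ := fun k => η ^ 2 / 2 * (1 / 8) ^ k with hδ
  have hδpos : ∀ k, 0 < δ k := fun k => by positivity
  let C : ℕ → ℝ := fun k => 1 - (1 / 2) ^ k
  let P : ℕ → E × E → Prop := fun k s => s.1 ∈ D ∧
    ∀ y ∈ D, f s.1 + inner ℝ s.2 (y - s.1) - C k * ‖y - s.1‖ ^ 2 - δ k ≤ f y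
  have hC0 : ∀ k, 0 ≤ C k := fun k => by
    have : ((1 : ℝ) / 2) ^ k ≤ 1 := pow_le_one₀ (by norm_num) (by norm_num)
    simp only [C]; linarith
  have hC1 : ∀ k, C k ≤ 1 := fun k => by
    have : (0 : ℝ) ≤ (1 / 2) ^ k := by positivity
    simp only [C]; linarith
  obtain ⟨x₀, hx₀, hmin₀⟩ : ∃ x₀ ∈ D, ∀ y ∈ D, f x₀ - η ^ 2 / 2 ≤ f y := by
    have hbdd : BddBelow (f '' D) := ⟨m, by rintro _ ⟨y, hy, rfl⟩; exact hm y hy⟩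
    obtain ⟨_, ⟨y, hy, rfl⟩, hlt⟩ := exists_lt_of_csInf_lt (Set.Nonempty.image f ⟨a, haD⟩)
      (lt_add_of_pos_right (sInf (f '' D)) (by positivity : 0 < η ^ 2 / 2))
    exact ⟨y, hy, fun w hw => by
      have := csInf_le hbdd ⟨w, hw, rfl⟩
      linarith⟩
  have hP0 : P 0 (x₀, 0) := ⟨hx₀, fun y hy => by simpa [C, hδ] using hmin₀ y hy⟩
  have step : ∀ k s, P k s → ∃ s' : E × E, P (k + 1) s' ∧
      ‖s'.1 - s.1‖ ≤ 2 * η / 2 / 2 ^ k ∧ ‖s'.2 - s.2‖ ≤ 4 * η / 2 / 2 ^ k := by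
    rintro k ⟨x, q⟩ ⟨hx, hq⟩
    obtain ⟨x', q', hx', hmin, hdist, hqq⟩ := exists_next_almost_minimizer hx (hC0 k)
      (by positivity : (0 : ℝ) < (1 / 2) ^ (k + 1)) (hδpos (k + 1)) hq
    have hCk : C k + (1 / 2) ^ (k + 1) = C (k + 1) := by simp only [C]; ring
    rw [hCk] at hmin hqq
    have hd : ‖x' - x‖ ≤ η / 2 ^ k := by
      refine le_of_sq_le_sq ?_ (by positivity)
      have e : δ k = (1 / 2) ^ (k + 1) * (η / 2 ^ k) ^ 2 := by
        have : (8 : ℝ) ^ k = 2 ^ k * (2 ^ k * 2 ^ k) := by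
          rw [← mul_pow, ← mul_pow]; norm_num
        simp only [hδ, one_div, inv_pow, pow_succ, this]
        field_simp
      rw [e] at hdist
      exact le_of_mul_le_mul_left hdist (by positivity)
    refine ⟨(x', q'), ⟨hx', hmin⟩, ?_, ?_⟩
    · calc ‖x' - x‖ ≤ η / 2 ^ k := hd
        _ = _ := by ring
    · calc ‖q' - q‖ ≤ 2 * C (k + 1) * ‖x' - x‖ := hqq
        _ ≤ 2 * 1 * (η / 2 ^ k) := by gcongr; exact hC1 _
        _ = _ := by ring
  choose! F hFP hF1 hF2 using step
  let S : ℕ → E × E := fun k => Nat.rec (x₀, 0) (fun k s => F k s) k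
  have hS : ∀ k, P k (S k) := fun k => by
    induction k with
    | zero => exact hP0
    | succ k ih => exact hFP k _ ih
  have hd1 : ∀ k, dist (S k).1 (S (k + 1)).1 ≤ 2 * η / 2 / 2 ^ k := fun k => by
    rw [dist_comm, dist_eq_norm]; exact hF1 k _ (hS k)
  have hd2 : ∀ k, dist (S k).2 (S (k + 1)).2 ≤ 4 * η / 2 / 2 ^ k := fun k => by
    rw [dist_comm, dist_eq_norm]; exact hF2 k _ (hS k)
  obtain ⟨x, hx⟩ := cauchySeq_tendsto_of_complete (cauchySeq_of_le_geometric_two hd1)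
  obtain ⟨q, hq⟩ := cauchySeq_tendsto_of_complete (cauchySeq_of_le_geometric_two hd2)
  have hx0 : ‖x₀ - x‖ ≤ 2 * η := by
    rw [← dist_eq_norm]; exact dist_le_of_le_geometric_two_of_tendsto₀ hd1 hx
  have hq0 : ‖q‖ ≤ 4 * η := by
    have := dist_le_of_le_geometric_two_of_tendsto₀ hd2 hq
    rwa [show (S 0).2 = 0 from rfl, dist_zero_left] at this
  have hxD : x ∈ D := hD.mem_of_tendsto hx (Eventually.of_forall fun k => (hS k).1)
  have hsupp : ∀ y ∈ D, f x + inner ℝ q (y - x) - ‖y - x‖ ^ 2 ≤ f y := by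
    intro y hy
    have hfx : Tendsto (fun k => f (S k).1) atTop (𝓝 (f x)) :=
      (hf x hxD).tendsto.comp (tendsto_nhdsWithin_iff.2
        ⟨hx, Eventually.of_forall fun k => (hS k).1⟩)
    have hδ0 : Tendsto δ atTop (𝓝 0) := by
      simpa [hδ] using (tendsto_pow_atTop_nhds_zero_of_lt_one (by norm_num : (0 : ℝ) ≤ 1 / 8)
        (by norm_num)).const_mul (η ^ 2 / 2)
    have hyx : Tendsto (fun k => y - (S k).1) atTop (𝓝 (y - x)) := hx.const_sub y
    have hlim := ((hfx.add (hq.inner (𝕜 := ℝ) hyx)).sub (hyx.norm.pow 2)).sub hδ0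
    rw [sub_zero] at hlim
    refine le_of_tendsto hlim (Eventually.of_forall fun k => ?_)
    have h1 := (hS k).2 y hy
    have h2 : C k * ‖y - (S k).1‖ ^ 2 ≤ 1 * ‖y - (S k).1‖ ^ 2 := by gcongr; exact hC1 k
    linarith
  refine ⟨x, q, hxD, by linarith, ?_, hsupp⟩
  have h1 := hsupp x₀ hx₀
  have h2 := hmin₀ a haD
  have h3 : -(4 * η * (2 * η)) ≤ inner ℝ q (x₀ - x) := by
    have := abs_le.1 (abs_real_inner_le_norm q (x₀ - x))
    have h4 : ‖q‖ * ‖x₀ - x‖ ≤ 4 * η * (2 * η) := by gcongr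
    linarith [this.1]
  have h5 : ‖x₀ - x‖ ^ 2 ≤ (2 * η) ^ 2 := by gcongr
  nlinarith

end Variational

/-! ### A mean value inequality -/

section MeanValue

variable {E : Type*} [NormedAddCommGroup E] [InnerProductSpace ℝ E]

/-- A mean value inequality: if all quadratic subgradients of a Lipschitz function on a ball are
bounded by `L`, then the function falls below its value at the centre at most at rate `L`. Otherwise
`φ + L' ‖· - b‖` with `L' > L`, made large on the sphere by a penalty, would be almost minimized in
the interior at a point other than `b`, where `φ` has a subgradient longer than `L`. -/
theorem sub_le_of_norm_subgradient_le [CompleteSpace E] {φ : E → ℝ} {a b : E} {R K L : ℝ}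
    (hK0 : 0 ≤ K) (hL0 : 0 ≤ L)
    (hK : ∀ x ∈ Metric.closedBall b R, ∀ y ∈ Metric.closedBall b R, |φ x - φ y| ≤ K * ‖x - y‖)
    (hab : ‖a - b‖ < R)
    (hL : ∀ x ∈ Metric.ball b R, ∀ (p : E) (σ : ℝ),
      (∀ y ∈ Metric.closedBall b R, φ x + inner ℝ p (y - x) - σ * ‖y - x‖ ^ 2 ≤ φ y) → ‖p‖ ≤ L) :
    φ b - φ a ≤ L * ‖a - b‖ := by
  rcases eq_or_ne a b with rfl | hne
  · simp
  by_contra! hlt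
  set s := ‖a - b‖ with hs
  have hs0 : 0 < s := norm_pos_iff.2 (sub_ne_zero.2 hne)
  have hR : 0 < R := hs0.trans hab
  obtain ⟨L', hLL', hL's⟩ : ∃ L', L < L' ∧ L' * s < φ b - φ a := by
    have : L < (φ b - φ a) / s := by rwa [lt_div_iff₀ hs0]
    obtain ⟨L', h1, h2⟩ := exists_between this
    exact ⟨L', h1, by rwa [lt_div_iff₀ hs0] at h2⟩
  have hRs : 0 < R ^ 2 - s ^ 2 := by nlinarith
  set M := K * R / (R ^ 2 - s ^ 2) ^ 2 with hM
  have hM0 : 0 ≤ M := by positivity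
  set ψ : E → ℝ := fun x => φ x + L' * ‖x - b‖ + M * max (‖x - b‖ ^ 2 - s ^ 2) 0 ^ 2 with hψ
  have hbB : b ∈ Metric.closedBall b R := Metric.mem_closedBall_self hR.le
  have haB : a ∈ Metric.closedBall b R := by
    rw [mem_closedBall_iff_norm]; exact hab.le
  have hψa : ψ a = φ a + L' * s := by simp [hψ, ← hs]
  have hφcont : ContinuousOn φ (Metric.closedBall b R) := by
    have : LipschitzOnWith K.toNNReal φ (Metric.closedBall b R) :=
      LipschitzOnWith.of_dist_le_mul fun x hx y hy => by
        rw [Real.dist_eq, dist_eq_norm, Real.coe_toNNReal _ hK0]; exact hK x hx y hy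
    exact this.continuousOn
  have hψcont : ContinuousOn ψ (Metric.closedBall b R) := by
    have h1 : Continuous fun x : E => L' * ‖x - b‖ := by fun_prop
    have h2 : Continuous fun x : E => M * max (‖x - b‖ ^ 2 - s ^ 2) 0 ^ 2 := by fun_prop
    exact (hφcont.add h1.continuousOn).add h2.continuousOn
  have hL'0 : 0 < L' := by linarith
  have hφlow : ∀ y ∈ Metric.closedBall b R, φ b - K * ‖y - b‖ ≤ φ y := fun y hy => by
    have := (abs_le.1 (hK y hy b hbB)).1
    linarith
  have hψbdd : ∀ y ∈ Metric.closedBall b R, φ b - K * R ≤ ψ y := fun y hy => by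
    have h1 := hφlow y hy
    have h2 : K * ‖y - b‖ ≤ K * R := by
      gcongr; exact mem_closedBall_iff_norm.1 hy
    have h3 : 0 ≤ L' * ‖y - b‖ := by positivity
    have h4 : 0 ≤ M * max (‖y - b‖ ^ 2 - s ^ 2) 0 ^ 2 := by positivity
    simp only [hψ]
    linarith
  obtain ⟨ε, hε, hε1, hε2⟩ : ∃ ε : ℝ, 0 < ε ∧ ε < φ b - φ a - L' * s ∧ ε < L' - L := by
    obtain ⟨ε, h1, h2⟩ := exists_between
      (lt_min (sub_pos.2 hL's) (sub_pos.2 hLL'))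
    exact ⟨ε, h1, h2.trans_le (min_le_left _ _), h2.trans_le (min_le_right _ _)⟩
  obtain ⟨x, q, hxB, hq, hψx, hsupp⟩ := exists_quadratic_support Metric.isClosed_closedBall
    hψcont hψbdd haB hε
  have hψlt : ψ x < φ b := by linarith
  set t := ‖x - b‖ with ht
  have htR : t ≤ R := mem_closedBall_iff_norm.1 hxB
  have ht0 : 0 < t := by
    refine norm_pos_iff.2 (sub_ne_zero.2 ?_)
    rintro rfl
    have : φ x ≤ ψ x := by
      simp only [hψ, sub_self, norm_zero, mul_zero, add_zero]
      have : 0 ≤ M * max ((0 : ℝ) ^ 2 - s ^ 2) 0 ^ 2 := by positivity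
      linarith
    linarith
  have htlt : t < R := by
    refine lt_of_le_of_ne htR fun h => ?_
    have h1 := hφlow x hxB
    have h2 : M * max (t ^ 2 - s ^ 2) 0 ^ 2 = K * R := by
      rw [h, max_eq_left hRs.le, hM]; field_simp
    have h3 : 0 ≤ L' * t := by positivity
    have h4 : ψ x = φ x + L' * t + M * max (t ^ 2 - s ^ 2) 0 ^ 2 := rfl
    rw [← ht, h] at h1
    linarith
  set μ := max (t ^ 2 - s ^ 2) 0 with hμ
  have hμ0 : 0 ≤ μ := le_max_right _ _
  set β := L' / t + 4 * M * μ with hβ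
  have hβ0 : 0 ≤ β := by positivity
  have key := hL x (mem_ball_iff_norm.2 htlt) (q - β • (x - b))
    (1 + L' / (2 * t) + M * (2 * μ + 4 * R ^ 2)) ?_
  · have h1 : ‖β • (x - b)‖ = β * t := by rw [norm_smul, Real.norm_of_nonneg hβ0]
    have h2 : L' ≤ β * t := by
      have : 0 ≤ 4 * M * μ * t := by positivity
      rw [hβ, add_mul, div_mul_cancel₀ _ ht0.ne']
      linarith
    have h3 := norm_sub_norm_le (β • (x - b)) q
    rw [norm_sub_rev] at h3
    linarith
  · intro y hy
    have hyR : ‖y - b‖ ≤ R := mem_closedBall_iff_norm.1 hy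
    have h1 := hsupp y hy
    set i := inner ℝ (x - b) (y - x) with hi
    set d := ‖y - x‖ with hd
    set τ := ‖y - b‖ with hτ
    have hτ0 : 0 ≤ τ := norm_nonneg _
    have e1 : τ ^ 2 = t ^ 2 + (2 * i + d ^ 2) := by
      have : y - b = (x - b) + (y - x) := by abel
      rw [hτ, this, norm_add_sq_real]; ring
    have e2 : τ ≤ t + (2 * i + d ^ 2) / (2 * t) := by
      have : t + (2 * i + d ^ 2) / (2 * t) = τ + (τ - t) ^ 2 / (2 * t) := by
        rw [show 2 * i + d ^ 2 = τ ^ 2 - t ^ 2 by linarith]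
        field_simp
        ring
      rw [this]
      have : 0 ≤ (τ - t) ^ 2 / (2 * t) := by positivity
      linarith
    have e3 : (2 * i + d ^ 2) ^ 2 ≤ 4 * R ^ 2 * d ^ 2 := by
      have h2 : |τ - t| ≤ d := by
        have := abs_norm_sub_norm_le (y - b) (x - b)
        rwa [sub_sub_sub_cancel_right] at this
      have h3 : (τ - t) ^ 2 ≤ d ^ 2 := sq_le_sq' (by linarith [(abs_le.1 h2).1]) (abs_le.1 h2).2
      have h4 : (τ + t) ^ 2 ≤ (2 * R) ^ 2 := by gcongr; linarith
      have h5 : 2 * i + d ^ 2 = (τ - t) * (τ + t) := by linarith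
      rw [h5, mul_pow]
      calc (τ - t) ^ 2 * (τ + t) ^ 2 ≤ d ^ 2 * (2 * R) ^ 2 := by gcongr
        _ = _ := by ring
    have e4 : max (τ ^ 2 - s ^ 2) 0 ^ 2 ≤ μ ^ 2 + 2 * μ * (2 * i + d ^ 2) + 4 * R ^ 2 * d ^ 2 := by
      refine le_trans ?_ (add_le_add_right e3 _)
      rw [show μ ^ 2 + 2 * μ * (2 * i + d ^ 2) + (2 * i + d ^ 2) ^ 2 = (μ + (2 * i + d ^ 2)) ^ 2 by
        ring]
      rcases le_total (τ ^ 2 - s ^ 2) 0 with h | h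
      · rw [max_eq_right h, zero_pow two_ne_zero]; exact sq_nonneg _
      · rw [max_eq_left h]
        gcongr
        linarith [le_max_left (t ^ 2 - s ^ 2) 0]
    have e5 : L' * τ ≤ L' * t + L' / t * i + L' / (2 * t) * d ^ 2 := by
      calc L' * τ ≤ L' * (t + (2 * i + d ^ 2) / (2 * t)) := by gcongr
        _ = _ := by field_simp; ring
    have e6 := mul_le_mul_of_nonneg_left e4 hM0
    have h4 : ψ x = φ x + L' * t + M * μ ^ 2 := rfl
    have h5 : ψ y = φ y + L' * τ + M * max (τ ^ 2 - s ^ 2) 0 ^ 2 := rfl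
    rw [inner_sub_left, real_inner_smul_left, ← hi, hβ]
    rw [h4, h5] at h1
    linarith

end MeanValue

/-! ### Local surjectivity of `I + c T` -/

section Local

variable {X : Type*} [NormedAddCommGroup X] [InnerProductSpace ℝ X]

/-- The inequality `⟪v₁ - v₂, u₁ - u₂⟫ ≥ -r ‖u₁ - u₂‖²` for points of the graph of `T` over `U`.
The constant may be negative: with `-κ` in place of `r` this is strong monotonicity on `U`. -/
def IsHypomonotoneOn (T : X → Set X) (U : Set X) (r : ℝ) : Prop :=
  ∀ ⦃u₁ v₁ u₂ v₂ : X⦄, v₁ ∈ T u₁ → u₁ ∈ U → v₂ ∈ T u₂ → u₂ ∈ U →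
    -r * ‖u₁ - u₂‖ ^ 2 ≤ inner ℝ (v₁ - v₂) (u₁ - u₂)

/-- Positivity, with modulus `κ`, of all regular coderivatives of `T`. -/
def HasCoderivativeBound (T : X → Set X) (κ : ℝ) : Prop :=
  ∀ ⦃u v : X⦄, v ∈ T u → ∀ ⦃w z : X⦄, z ∈ regularCoderivative T u v w → κ * ‖w‖ ^ 2 ≤ inner ℝ z w

/-- Quadratic (proximal) normals to the graph give elements of the regular coderivative. -/
lemma mem_regularCoderivative_of_le {T : X → Set X} {u v w z : X} {C : ℝ} (hv : v ∈ T u)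
    (hC : 0 ≤ C)
    (h : ∀ᶠ p : X × X in 𝓝 (u, v), p.2 ∈ T p.1 →
      inner ℝ z (p.1 - u) - inner ℝ w (p.2 - v) ≤ C * (‖p.1 - u‖ + ‖p.2 - v‖) ^ 2) :
    z ∈ regularCoderivative T u v w := by
  refine ⟨hv, fun ε hε => ?_⟩
  rw [eventually_nhdsWithin_iff]
  have h1 := (WithLp.prod_continuous_ofLp 2 X X).tendsto (WithLp.toLp 2 (u, v)) |>.eventually h
  have h2 : ∀ᶠ y : WithLp 2 (X × X) in 𝓝 (WithLp.toLp 2 (u, v)),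
      4 * C * ‖y - WithLp.toLp 2 (u, v)‖ < ε := by
    have : Continuous fun y : WithLp 2 (X × X) => 4 * C * ‖y - WithLp.toLp 2 (u, v)‖ := by fun_prop
    refine this.tendsto _ |>.eventually_lt_const ?_
    simpa using hε
  filter_upwards [h1, h2] with y hy1 hy2 hyT
  set d := y - WithLp.toLp 2 (u, v) with hd
  have hd1 : ‖y.ofLp.1 - u‖ ≤ ‖d‖ := WithLp.norm_fst_le X d
  have hd2 : ‖y.ofLp.2 - v‖ ≤ ‖d‖ := WithLp.norm_snd_le X d
  rw [WithLp.prod_inner_apply]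
  change inner ℝ z (y.ofLp.1 - u) + inner ℝ (-w) (y.ofLp.2 - v) ≤ _
  rw [inner_neg_left, ← sub_eq_add_neg]
  calc inner ℝ z (y.ofLp.1 - u) - inner ℝ w (y.ofLp.2 - v)
      ≤ C * (‖y.ofLp.1 - u‖ + ‖y.ofLp.2 - v‖) ^ 2 := hy1 hyT
    _ ≤ C * (‖d‖ + ‖d‖) ^ 2 := by gcongr
    _ = 4 * C * ‖d‖ * ‖d‖ := by ring
    _ ≤ ε * ‖d‖ := by gcongr

/-- The form of `mem_regularCoderivative_of_le` used with the resolvent of `T`, in the variable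
`x = u + c v`. -/
lemma mem_regularCoderivative_of_add_smul_le {T : X → Set X} {u v w p : X} {c σ : ℝ}
    (hv : v ∈ T u) (hc : 0 ≤ c)
    (h : ∀ᶠ q : X × X in 𝓝 (u, v), q.2 ∈ T q.1 →
      inner ℝ w (q.1 + c • q.2 - (u + c • v)) - σ * ‖q.1 + c • q.2 - (u + c • v)‖ ^ 2 ≤
        inner ℝ p (q.1 - u)) :
    w - p ∈ regularCoderivative T u v (-c • w) := by
  refine mem_regularCoderivative_of_le (C := |σ| * (1 + c) ^ 2) hv (by positivity) ?_
  filter_upwards [h] with q hq hqT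
  have h1 := hq hqT
  set d := q.1 + c • q.2 - (u + c • v) with hd
  have e : d = (q.1 - u) + c • (q.2 - v) := by rw [hd, smul_sub]; abel
  have h2 : ‖d‖ ≤ (1 + c) * (‖q.1 - u‖ + ‖q.2 - v‖) := by
    rw [e]
    refine (norm_add_le _ _).trans ?_
    rw [norm_smul, Real.norm_of_nonneg hc]
    nlinarith [norm_nonneg (q.1 - u), norm_nonneg (q.2 - v)]
  have h3 : σ * ‖d‖ ^ 2 ≤ |σ| * ((1 + c) * (‖q.1 - u‖ + ‖q.2 - v‖)) ^ 2 := by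
    calc σ * ‖d‖ ^ 2 ≤ |σ| * ‖d‖ ^ 2 := by gcongr; exact le_abs_self σ
      _ ≤ _ := by gcongr
  have h4 : inner ℝ w d = inner ℝ w (q.1 - u) + c * inner ℝ w (q.2 - v) := by
    rw [e, inner_add_right, real_inner_smul_right]
  rw [inner_sub_left, real_inner_smul_left]
  rw [mul_pow] at h3
  linarith

lemma IsHypomonotoneOn.mono {T : X → Set X} {U V : Set X} {r : ℝ} (h : IsHypomonotoneOn T U r)
    (hVU : V ⊆ U) : IsHypomonotoneOn T V r :=
  fun _ _ _ _ h1 h1' h2 h2' => h h1 (hVU h1') h2 (hVU h2')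

/-- The resolvent `(I + c T)⁻¹` of a hypomonotone mapping is Lipschitz for small `c`. -/
lemma IsHypomonotoneOn.norm_sub_le {T : X → Set X} {U : Set X} {r c : ℝ}
    (h : IsHypomonotoneOn T U r) (hc : 0 ≤ c) (hcr : c * r ≤ 1 / 2) {u₁ v₁ u₂ v₂ : X}
    (hv₁ : v₁ ∈ T u₁) (hu₁ : u₁ ∈ U) (hv₂ : v₂ ∈ T u₂) (hu₂ : u₂ ∈ U) :
    ‖u₁ - u₂‖ ≤ 2 * ‖(u₁ + c • v₁) - (u₂ + c • v₂)‖ := by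
  have h1 := mul_le_mul_of_nonneg_left (h hv₁ hu₁ hv₂ hu₂) hc
  set d := (u₁ + c • v₁) - (u₂ + c • v₂) with hd
  have e : d = (u₁ - u₂) + c • (v₁ - v₂) := by rw [hd, smul_sub]; abel
  have h2 : inner ℝ d (u₁ - u₂) = ‖u₁ - u₂‖ ^ 2 + c * inner ℝ (v₁ - v₂) (u₁ - u₂) := by
    rw [e, inner_add_left, real_inner_smul_left, real_inner_self_eq_norm_sq]
  have h3 := real_inner_le_norm d (u₁ - u₂)
  have h4 : c * r * ‖u₁ - u₂‖ ^ 2 ≤ 1 / 2 * ‖u₁ - u₂‖ ^ 2 := by gcongr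
  by_contra! hlt
  have h5 : 0 < ‖u₁ - u₂‖ := lt_of_le_of_lt (by positivity) hlt
  nlinarith

/-- Under the coderivative bound with `κ ≥ 0`, the range of `I + c T` contains a ball around
`a + c b` whenever `b ∈ T a`, of a radius depending only on that of the ball around `a` on which
`T` is hypomonotone. The range is locally closed. A point `y` off the range would have an almost
nearest point `u + c v` in it and a normal `n ≠ 0` there; then `n ∈ D̂*T(u, v)(-c n)`, which the
bound forbids. -/
theorem exists_add_smul_eq [CompleteSpace X] {T : X → Set X} (hclosed : IsClosed (gph T))
    {κ : ℝ} (hκ : 0 ≤ κ) (hT : HasCoderivativeBound T κ) {a b : X} (hb : b ∈ T a) {ρ r c : ℝ}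
    (hρ : 0 < ρ) (hr : IsHypomonotoneOn T (Metric.ball a ρ) r) (hc : 0 < c)
    (hcr : c * r ≤ 1 / 2) {y : X} (hy : ‖y - (a + c • b)‖ < ρ / 8) :
    ∃ u ∈ Metric.ball a ρ, ∃ v ∈ T u, u + c • v = y := by
  set x₀ := a + c • b with hx₀
  set D : Set X := {x | ‖x - x₀‖ ≤ ρ / 3 ∧ ∃ u ∈ Metric.ball a ρ, ∃ v ∈ T u, u + c • v = x}
  have haρ : a ∈ Metric.ball a ρ := Metric.mem_ball_self hρ
  have hx₀D : x₀ ∈ D := ⟨by rw [sub_self, norm_zero]; positivity, a, haρ, b, hb, rfl⟩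
  have hD : IsClosed D := by
    refine IsSeqClosed.isClosed fun x x' hx hlim => ?_
    choose hxρ u hu v hv huv using hx
    have hcauchy : CauchySeq u := by
      rw [Metric.cauchySeq_iff]
      intro ε hε
      obtain ⟨N, hN⟩ := Metric.cauchySeq_iff.1 hlim.cauchySeq (ε / 2) (by positivity)
      refine ⟨N, fun m hm n hn => ?_⟩
      have h1 := hr.norm_sub_le hc.le hcr (hv m) (hu m) (hv n) (hu n)
      have h2 := hN m hm n hn
      rw [huv, huv] at h1
      rw [dist_eq_norm] at h2 ⊢
      linarith
    obtain ⟨u', hu'⟩ := cauchySeq_tendsto_of_complete hcauchy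
    have hv' : Tendsto v atTop (𝓝 (c⁻¹ • (x' - u'))) := by
      have : v = fun n => c⁻¹ • (x n - u n) := by
        ext1 n
        rw [← huv n, add_sub_cancel_left, inv_smul_smul₀ hc.ne']
      rw [this]
      exact (hlim.sub hu').const_smul _
    have hgph : (u', c⁻¹ • (x' - u')) ∈ gph T :=
      hclosed.mem_of_tendsto (hu'.prodMk_nhds hv') (Eventually.of_forall hv)
    refine ⟨le_of_tendsto (hlim.sub_const x₀).norm (Eventually.of_forall hxρ), u', ?_, _, hgph, ?_⟩
    · have : ‖u' - a‖ ≤ 2 * (ρ / 3) := by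
        refine le_of_tendsto (hu'.sub_const a).norm (Eventually.of_forall fun n => ?_)
        have h1 := hr.norm_sub_le hc.le hcr (hv n) (hu n) hb haρ
        rw [huv] at h1
        linarith [hxρ n]
      rw [mem_ball_iff_norm]
      linarith
    · rw [smul_inv_smul₀ hc.ne']; abel
  suffices hyD : y ∈ D from hyD.2
  by_contra hyD
  obtain ⟨δ, hδ, hball⟩ := Metric.isOpen_iff.1 hD.isOpen_compl y hyD
  have hfar : ∀ x ∈ D, δ ≤ ‖y - x‖ := fun x hx => by
    by_contra! h
    exact hball (by rwa [mem_ball_iff_norm, norm_sub_rev] : x ∈ Metric.ball y δ) hx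
  obtain ⟨ε, hε, hε1, hε2⟩ : ∃ ε : ℝ, 0 < ε ∧ ε < δ ∧ ε < (ρ / 8) ^ 2 - ‖y - x₀‖ ^ 2 := by
    have : ‖y - x₀‖ ^ 2 < (ρ / 8) ^ 2 := by gcongr
    obtain ⟨ε, h1, h2⟩ := exists_between (lt_min hδ (sub_pos.2 this))
    exact ⟨ε, h1, h2.trans_le (min_le_left _ _), h2.trans_le (min_le_right _ _)⟩
  have hcont : ContinuousOn (fun x => ‖y - x‖ ^ 2) D := by fun_prop
  obtain ⟨x, q, hxD, hq, hfx, hsupp⟩ := exists_quadratic_support hD hcont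
    (fun x _ => by positivity : ∀ x ∈ D, (0 : ℝ) ≤ ‖y - x‖ ^ 2) hx₀D hε
  obtain ⟨hxρ, u, hu, v, hv, huv⟩ := hxD
  have hyx : ‖y - x‖ < ρ / 8 := by
    refine lt_of_pow_lt_pow_left₀ 2 (by positivity) ?_
    linarith
  have hxlt : ‖x - x₀‖ < ρ / 3 := by
    have := norm_sub_le_norm_sub_add_norm_sub x y x₀
    rw [norm_sub_rev x y] at this
    linarith
  set n := (2 : ℝ) • (y - x) + q with hn
  have hn0 : 0 < ‖n‖ := by
    have h1 := norm_sub_norm_le ((2 : ℝ) • (y - x)) (-q)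
    rw [sub_neg_eq_add, norm_smul, norm_neg, Real.norm_ofNat] at h1
    have h2 := hfar x ⟨hxρ, u, hu, v, hv, huv⟩
    linarith
  have hnormal : ∀ x' ∈ D, inner ℝ n (x' - x) - 2 * ‖x' - x‖ ^ 2 ≤ 0 := by
    intro x' hx'
    have h1 := hsupp x' hx'
    have e : ‖y - x'‖ ^ 2 = ‖y - x‖ ^ 2 - 2 * inner ℝ (y - x) (x' - x) + ‖x' - x‖ ^ 2 := by
      rw [← norm_sub_sq_real, sub_sub_sub_cancel_right]
    rw [hn, inner_add_left, real_inner_smul_left]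
    simp only [e] at h1
    linarith
  have hmem : n - 0 ∈ regularCoderivative T u v (-c • n) := by
    refine mem_regularCoderivative_of_add_smul_le (σ := 2) hv hc.le ?_
    have ev1 : ∀ᶠ p : X × X in 𝓝 (u, v), p.1 ∈ Metric.ball a ρ :=
      continuous_fst.tendsto (u, v) |>.eventually (Metric.isOpen_ball.mem_nhds hu)
    have ev2 : ∀ᶠ p : X × X in 𝓝 (u, v), ‖p.1 + c • p.2 - x₀‖ < ρ / 3 := by
      have : Continuous fun p : X × X => ‖p.1 + c • p.2 - x₀‖ := by fun_prop
      refine this.tendsto (u, v) |>.eventually_lt_const ?_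
      simpa only [huv] using hxlt
    filter_upwards [ev1, ev2] with p hp1 hp2 hpT
    rw [inner_zero_left, huv]
    exact hnormal _ ⟨hp2.le, p.1, hp1, p.2, hpT, rfl⟩
  have hbound := hT hv hmem
  rw [sub_zero, real_inner_smul_right, real_inner_self_eq_norm_sq] at hbound
  have h1 : 0 < c * ‖n‖ ^ 2 := by positivity
  have h2 : 0 ≤ κ * ‖-c • n‖ ^ 2 := by positivity
  linarith

end Local

/-! ### From the coderivative bound to local strong monotonicity -/

section StrongMonotonicity

variable {X : Type*} [NormedAddCommGroup X] [InnerProductSpace ℝ X]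

/-- A quadratic inequality of strong monotonicity type, written as membership in a ball. -/
lemma norm_sub_smul_le_iff {m : ℝ} (hm : 0 < m) {w p : X} :
    ‖w - (2 * m)⁻¹ • p‖ ≤ (2 * m)⁻¹ * ‖p‖ ↔ m * ‖w‖ ^ 2 ≤ inner ℝ p w := by
  rw [← sq_le_sq₀ (norm_nonneg _) (by positivity), norm_sub_sq_real, mul_pow, norm_smul, mul_pow,
    Real.norm_of_nonneg (by positivity), real_inner_smul_right, real_inner_comm p w]
  have e : 2 * ((2 * m)⁻¹ * inner ℝ p w) = inner ℝ p w / m := by field_simp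
  rw [e]
  constructor
  · intro h
    have h1 : ‖w‖ ^ 2 ≤ inner ℝ p w / m := by linarith
    rw [le_div_iff₀ hm] at h1
    linarith
  · intro h
    have h1 : ‖w‖ ^ 2 ≤ inner ℝ p w / m := by rw [le_div_iff₀ hm]; linarith
    linarith

/-- Under the coderivative bound, hypomonotonicity on a ball improves to strong monotonicity with
modulus `κ` on a smaller ball. For the resolvent `J = (I + c T)⁻¹` and a vector `p`, the bound says
that the subgradients `w` of `⟪p, J ·⟫` satisfy `(1 + κ c) ‖w‖² ≤ ⟪p, w⟫`, which is a bound on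
the subgradients of `⟪p, J ·⟫ - (2 (1 + κ c))⁻¹ ⟪p, ·⟫`; the mean value inequality turns it into the
same inequality for the increments of `J`. The values of `T` near `a` need not be bounded, so `c`
depends on the two graph points under consideration. -/
theorem IsHypomonotoneOn.neg_of_coderivativeBound [CompleteSpace X] {T : X → Set X}
    (hclosed : IsClosed (gph T)) {κ : ℝ} (hκ : 0 ≤ κ) (hT : HasCoderivativeBound T κ) {a : X}
    (ha : a ∈ dom T) {ρ r : ℝ} (hρ : 0 < ρ) (hr0 : 0 < r)
    (hr : IsHypomonotoneOn T (Metric.ball a ρ) r) :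
    IsHypomonotoneOn T (Metric.ball a (ρ / 64)) (-κ) := by
  obtain ⟨b, hb⟩ := ha
  intro u₁ v₁ u₂ v₂ hv₁ hu₁ hv₂ hu₂
  set N := 1 + ‖v₁ - b‖ + ‖v₂ - b‖ with hN
  have hN0 : 0 < N := by positivity
  obtain ⟨c, hc, hcr, hcN⟩ : ∃ c : ℝ, 0 < c ∧ c * r ≤ 1 / 2 ∧ c * N ≤ ρ / 64 := by
    refine ⟨min (1 / 2 / r) (ρ / 64 / N), by positivity, ?_, ?_⟩
    · rw [← le_div_iff₀ hr0]; exact min_le_left _ _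
    · rw [← le_div_iff₀ hN0]; exact min_le_right _ _
  set x₀ := a + c • b with hx₀
  set x₁ := u₁ + c • v₁ with hx₁
  set x₂ := u₂ + c • v₂ with hx₂
  have hsub : Metric.ball a (ρ / 64) ⊆ Metric.ball a ρ := Metric.ball_subset_ball (by linarith)
  have hnear : ∀ u v : X, u ∈ Metric.ball a (ρ / 64) → ‖v - b‖ ≤ N →
      ‖u + c • v - x₀‖ ≤ ρ / 32 := by
    intro u v hu hv
    have e : u + c • v - x₀ = (u - a) + c • (v - b) := by rw [hx₀, smul_sub]; abel
    have h1 : ‖c • (v - b)‖ ≤ c * N := by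
      rw [norm_smul, Real.norm_of_nonneg hc.le]; gcongr
    have h2 := mem_ball_iff_norm.1 hu
    rw [e]
    linarith [norm_add_le (u - a) (c • (v - b))]
  have hx₁n : ‖x₁ - x₀‖ ≤ ρ / 32 := hnear _ _ hu₁ (by linarith [norm_nonneg (v₂ - b)])
  have hx₂n : ‖x₂ - x₀‖ ≤ ρ / 32 := hnear _ _ hu₂ (by linarith [norm_nonneg (v₁ - b)])
  have hx₂₁ : ‖x₂ - x₁‖ < ρ / 12 := by
    have := norm_sub_le_norm_sub_add_norm_sub x₂ x₀ x₁
    rw [norm_sub_rev x₀ x₁] at this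
    linarith
  have hballs : ∀ x ∈ Metric.closedBall x₁ (ρ / 12), ‖x - x₀‖ < ρ / 8 := fun x hx => by
    have := norm_sub_le_norm_sub_add_norm_sub x x₁ x₀
    have h1 := mem_closedBall_iff_norm.1 hx
    linarith
  have hres : ∀ x : X, ‖x - x₀‖ < ρ / 8 → ∃ u : X, u ∈ Metric.ball a ρ ∧ ∃ v ∈ T u, u + c • v = x :=
    fun x hx => exists_add_smul_eq hclosed hκ hT hb hρ hr hc hcr hx
  choose! J hJρ V hJT hJV using hres
  have hJeq : ∀ u v : X, v ∈ T u → u ∈ Metric.ball a ρ → ‖u + c • v - x₀‖ < ρ / 8 →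
      J (u + c • v) = u := by
    intro u v hv hu hx
    have h1 := hr.norm_sub_le hc.le hcr (hJT _ hx) (hJρ _ hx) hv hu
    rw [hJV _ hx, sub_self, norm_zero, mul_zero] at h1
    exact sub_eq_zero.1 (norm_le_zero_iff.1 h1)
  have hJ₁ : J x₁ = u₁ := hJeq _ _ hv₁ (hsub hu₁) (by linarith)
  have hJ₂ : J x₂ = u₂ := hJeq _ _ hv₂ (hsub hu₂) (by linarith)
  have hJlip : ∀ x ∈ Metric.closedBall x₁ (ρ / 12), ∀ y ∈ Metric.closedBall x₁ (ρ / 12),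
      ‖J x - J y‖ ≤ 2 * ‖x - y‖ := by
    intro x hx y hy
    have hx' := hballs x hx
    have hy' := hballs y hy
    have := hr.norm_sub_le hc.le hcr (hJT _ hx') (hJρ _ hx') (hJT _ hy') (hJρ _ hy')
    rwa [hJV _ hx', hJV _ hy'] at this
  set m := 1 + κ * c with hm
  have hm0 : 0 < m := by positivity
  set γ := (2 * m)⁻¹ with hγ
  have hγ0 : 0 < γ := by positivity
  have hmean : ∀ p : X,
      (inner ℝ p (J x₁) - γ * inner ℝ p x₁) - (inner ℝ p (J x₂) - γ * inner ℝ p x₂)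
      ≤ γ * ‖p‖ * ‖x₂ - x₁‖ := by
    intro p
    refine sub_le_of_norm_subgradient_le (φ := fun x => inner ℝ p (J x) - γ * inner ℝ p x)
      (K := ‖p‖ * (2 + γ)) (by positivity) (by positivity) ?_ hx₂₁ ?_
    · intro x hx y hy
      have e : inner ℝ p (J x) - γ * inner ℝ p x - (inner ℝ p (J y) - γ * inner ℝ p y) =
          inner ℝ p ((J x - J y) - γ • (x - y)) := by
        simp only [inner_sub_right, real_inner_smul_right]; ring
      have h1 : ‖(J x - J y) - γ • (x - y)‖ ≤ (2 + γ) * ‖x - y‖ := by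
        have h2 := _root_.norm_sub_le (J x - J y) (γ • (x - y))
        rw [norm_smul, Real.norm_of_nonneg hγ0.le] at h2
        linarith [hJlip x hx y hy]
      rw [e]
      calc _ ≤ ‖p‖ * ‖(J x - J y) - γ • (x - y)‖ := abs_real_inner_le_norm _ _
        _ ≤ ‖p‖ * ((2 + γ) * ‖x - y‖) := by gcongr
        _ = _ := by ring
    · intro x hx w' σ hw'
      have hx' := hballs x (Metric.ball_subset_closedBall hx)
      have hmem : (w' + γ • p) - p ∈ regularCoderivative T (J x) (V x) (-c • (w' + γ • p)) := by
        refine mem_regularCoderivative_of_add_smul_le (σ := σ) (hJT _ hx') hc.le ?_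
        have ev1 : ∀ᶠ q : X × X in 𝓝 (J x, V x), q.1 ∈ Metric.ball a ρ :=
          continuous_fst.tendsto (J x, V x) |>.eventually (Metric.isOpen_ball.mem_nhds (hJρ _ hx'))
        have ev2 : ∀ᶠ q : X × X in 𝓝 (J x, V x), q.1 + c • q.2 ∈ Metric.ball x₁ (ρ / 12) := by
          have : Continuous fun q : X × X => q.1 + c • q.2 := by fun_prop
          refine this.tendsto (J x, V x) |>.eventually (Metric.isOpen_ball.mem_nhds ?_)
          simpa only [hJV _ hx'] using hx
        filter_upwards [ev1, ev2] with q hq1 hq2 hqT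
        have hq3 := Metric.ball_subset_closedBall hq2
        have h1 := hw' _ hq3
        rw [hJeq _ _ hqT hq1 (hballs _ hq3)] at h1
        rw [hJV _ hx', inner_add_left, real_inner_smul_left, inner_sub_right p, inner_sub_right p]
        linarith
      have h1 := hT (hJT _ hx') hmem
      set w := w' + γ • p with hw
      have h2 : m * ‖w‖ ^ 2 ≤ inner ℝ p w := by
        rw [real_inner_smul_right, inner_sub_left, real_inner_self_eq_norm_sq, norm_smul, mul_pow,
          norm_neg, Real.norm_of_nonneg hc.le] at h1
        have h3 : c * (m * ‖w‖ ^ 2) ≤ c * inner ℝ p w := by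
          rw [hm]; linarith
        exact le_of_mul_le_mul_left h3 hc
      have h3 := (norm_sub_smul_le_iff hm0).2 h2
      rwa [hw, add_sub_cancel_right] at h3
  rw [hJ₁, hJ₂] at hmean
  have hball : ‖(u₁ - u₂) - γ • (x₁ - x₂)‖ ≤ γ * ‖x₁ - x₂‖ := by
    set p := (u₁ - u₂) - γ • (x₁ - x₂) with hp
    have h1 := hmean p
    have e : inner ℝ p u₁ - γ * inner ℝ p x₁ - (inner ℝ p u₂ - γ * inner ℝ p x₂) = ‖p‖ ^ 2 := by
      rw [← real_inner_self_eq_norm_sq]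
      nth_rw 6 [hp]
      simp only [inner_sub_right, real_inner_smul_right]; ring
    rw [e, norm_sub_rev x₂ x₁] at h1
    rcases (norm_nonneg p).eq_or_lt' with h0 | h0
    · rw [h0]; positivity
    · refine le_of_mul_le_mul_left ?_ h0
      linarith
  have h1 := (norm_sub_smul_le_iff hm0).1 hball
  have e : x₁ - x₂ = (u₁ - u₂) + c • (v₁ - v₂) := by rw [hx₁, hx₂, smul_sub]; abel
  rw [e, inner_add_left, real_inner_smul_left, real_inner_self_eq_norm_sq, hm] at h1
  have h2 : c * (κ * ‖u₁ - u₂‖ ^ 2) ≤ c * inner ℝ (v₁ - v₂) (u₁ - u₂) := by linarith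
  rw [neg_neg]
  exact le_of_mul_le_mul_left h2 hc

end StrongMonotonicity

/-! ### From local to global -/

section Global

variable {X : Type*} [NormedAddCommGroup X] [InnerProductSpace ℝ X]

lemma isHypomonotone_iff {T : X → Set X} :
    IsHypomonotone T ↔ ∃ r : ℝ, 0 < r ∧ IsHypomonotoneOn T Set.univ r :=
  ⟨fun ⟨r, hr, h⟩ => ⟨r, hr, fun u₁ v₁ u₂ v₂ h₁ _ h₂ _ => h (u₁, v₁) h₁ (u₂, v₂) h₂⟩,
    fun ⟨r, hr, h⟩ => ⟨r, hr, fun _ hp _ hq => h hp trivial hq trivial⟩⟩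

lemma isSemilocallyHypomonotone_iff {T : X → Set X} :
    IsSemilocallyHypomonotone T ↔
      ∀ a ∈ dom T, ∃ ρ : ℝ, 0 < ρ ∧ ∃ r : ℝ, 0 < r ∧ IsHypomonotoneOn T (Metric.ball a ρ) r := by
  refine forall₂_congr fun a _ => ⟨?_, ?_⟩
  · rintro ⟨U, hU, r, hr, h⟩
    obtain ⟨ρ, hρ, hρU⟩ := Metric.mem_nhds_iff.1 hU
    exact ⟨ρ, hρ, r, hr, fun u₁ v₁ u₂ v₂ h₁ h₁' h₂ h₂' =>
      h (u₁, v₁) ⟨h₁, hρU h₁', trivial⟩ (u₂, v₂) ⟨h₂, hρU h₂', trivial⟩⟩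
  · rintro ⟨ρ, hρ, r, hr, h⟩
    exact ⟨_, Metric.ball_mem_nhds a hρ, r, hr, fun _ hp _ hq => h hp.1 hp.2.1 hq.1 hq.2.1⟩

lemma isMonotone_addSmulId_iff {T : X → Set X} {c : ℝ} :
    IsMonotone (addSmulId T c) ↔ IsHypomonotoneOn T Set.univ c := by
  have e : ∀ u₁ v₁ u₂ v₂ : X, inner ℝ (v₁ + c • u₁ - (v₂ + c • u₂)) (u₁ - u₂) =
      inner ℝ (v₁ - v₂) (u₁ - u₂) + c * ‖u₁ - u₂‖ ^ 2 := by
    intro u₁ v₁ u₂ v₂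
    rw [← real_inner_self_eq_norm_sq, ← real_inner_smul_left, ← inner_add_left, smul_sub]
    congr 1
    abel
  constructor
  · intro h u₁ v₁ u₂ v₂ h₁ _ h₂ _
    have := h (u₁, v₁ + c • u₁) ⟨v₁, h₁, rfl⟩ (u₂, v₂ + c • u₂) ⟨v₂, h₂, rfl⟩
    rw [e] at this
    linarith
  · rintro h ⟨u₁, w₁⟩ ⟨v₁, h₁, hw₁⟩ ⟨u₂, w₂⟩ ⟨v₂, h₂, hw₂⟩
    have := h h₁ trivial h₂ trivial
    obtain rfl : v₁ + c • u₁ = w₁ := hw₁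
    obtain rfl : v₂ + c • u₂ = w₂ := hw₂
    change 0 ≤ inner ℝ (v₁ + c • u₁ - (v₂ + c • u₂)) (u₁ - u₂)
    rw [e]
    linarith

lemma isMonotone_of_neg {T : X → Set X} {κ : ℝ} (hκ : 0 ≤ κ)
    (h : IsHypomonotoneOn T Set.univ (-κ)) : IsMonotone T := fun p hp q hq => by
  have h1 := h hp trivial hq trivial
  rw [neg_neg] at h1
  exact le_trans (by positivity) h1

/-- The elementary half of Minty's theorem. -/
lemma IsMonotone.isMaximalMonotone {T : X → Set X} (hT : IsMonotone T) {c : ℝ} (hc : 0 < c)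
    (hsurj : ∀ x : X, ∃ u, ∃ v ∈ T u, u + c • v = x) : IsMaximalMonotone T := by
  refine ⟨hT, fun S hS hTS => hTS.antisymm ?_⟩
  rintro ⟨u, v⟩ hv
  obtain ⟨u', v', hv', he⟩ := hsurj (u + c • v)
  have h1 : 0 ≤ inner ℝ (v - v') (u - u') := hS (u, v) hv (u', v') (hTS hv')
  have e : u - u' = -(c • (v - v')) := by
    rw [smul_sub, neg_sub, sub_eq_sub_iff_add_eq_add, add_comm (c • v'), he, add_comm]
  rw [e, inner_neg_right, real_inner_smul_right, real_inner_self_eq_norm_sq] at h1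
  have h2 : ‖v - v'‖ ^ 2 ≤ 0 := by
    by_contra! h
    nlinarith
  have h3 : v - v' = 0 := norm_eq_zero.1 (pow_eq_zero_iff two_ne_zero |>.1
    (le_antisymm h2 (by positivity)))
  rw [h3, smul_zero, neg_zero] at e
  rw [sub_eq_zero.1 e, sub_eq_zero.1 h3]
  exact hv'

theorem IsHypomonotone.isStronglyMaximalMonotone [CompleteSpace X] {T : X → Set X}
    (hne : (dom T).Nonempty) (hclosed : IsClosed (gph T)) {κ : ℝ} (hκ : 0 ≤ κ)
    (hT : HasCoderivativeBound T κ) (h : IsHypomonotone T) : IsStronglyMaximalMonotone κ T := by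
  obtain ⟨r, hr0, hr⟩ := isHypomonotone_iff.1 h
  have hmono : IsHypomonotoneOn T Set.univ (-κ) := by
    intro u₁ v₁ u₂ v₂ h₁ _ h₂ _
    have h64 : (0 : ℝ) < 64 * (‖u₂ - u₁‖ + 1) := by positivity
    refine (hr.mono (Set.subset_univ _)).neg_of_coderivativeBound hclosed hκ hT ⟨v₁, h₁⟩ h64
      hr0 h₁ ?_ h₂ ?_
    · exact Metric.mem_ball_self (by positivity)
    · rw [mem_ball_iff_norm]; linarith
  refine ⟨(isMonotone_of_neg hκ hmono).isMaximalMonotone (c := 1 / 2 / r) (by positivity)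
    fun x => ?_, isMonotone_addSmulId_iff.2 hmono⟩
  obtain ⟨a, b, hb⟩ := hne
  set d := ‖x - (a + (1 / 2 / r) • b)‖ with hd
  have hd0 : 0 ≤ d := norm_nonneg _
  obtain ⟨u, -, v, hv, huv⟩ := exists_add_smul_eq hclosed hκ hT hb (ρ := 8 * (d + 1))
    (by positivity)
    (hr.mono (Set.subset_univ _)) (by positivity : 0 < 1 / 2 / r)
    (by rw [div_mul_cancel₀ _ hr0.ne']) (y := x) (by linarith)
  exact ⟨u, v, hv, huv⟩

/-- Local hypomonotonicity inequalities with a common constant add up along segments in a convex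
domain. -/
theorem isHypomonotoneOn_univ_of_local {T : X → Set X} (hconv : Convex ℝ (dom T)) {s : ℝ}
    (h : ∀ a ∈ dom T, ∃ ρ : ℝ, 0 < ρ ∧ IsHypomonotoneOn T (Metric.ball a ρ) s) :
    IsHypomonotoneOn T Set.univ s := by
  intro u₁ v₁ u₂ v₂ h₁ _ h₂ _
  choose! ρ hρ hs using h
  set e := u₁ - u₂ with he
  let l : ℝ → X := fun t => u₂ + t • e
  have hl : Continuous l := by fun_prop
  have hdom : ∀ t ∈ Set.Icc (0 : ℝ) 1, l t ∈ dom T := fun t ht =>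
    hconv.add_smul_sub_mem ⟨v₂, h₂⟩ ⟨v₁, h₁⟩ ht
  obtain ⟨t, ht0, htm, ⟨n, hn⟩, htc⟩ := exists_monotone_Icc_subset_open_cover_Icc
    (zero_le_one' ℝ)
    (c := fun a : dom T => (fun t : Set.Icc (0 : ℝ) 1 => l t) ⁻¹' Metric.ball a (ρ a))
    (fun a => Metric.isOpen_ball.preimage (hl.comp continuous_subtype_val))
    (fun t _ => Set.mem_iUnion.2
      ⟨⟨l t, hdom t t.2⟩, Metric.mem_ball_self (hρ _ (hdom t t.2))⟩)
  -- At parameter `0` the inequality may fail for values of `T u₂` other than `v₂`.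
  have key : ∀ k, (t k : ℝ) = 0 ∨
      ∀ v ∈ T (l (t k)), -s * (t k * ‖e‖ ^ 2) ≤ inner ℝ (v - v₂) e := by
    intro k
    induction k with
    | zero => exact Or.inl ht0
    | succ k ih =>
      rcases (htm (Nat.le_succ k) : (t k : ℝ) ≤ t (k + 1)).eq_or_lt with heq | hlt
      · rwa [← heq]
      right
      intro v hv
      obtain ⟨v', hv', hle⟩ : ∃ v' ∈ T (l (t k)),
          -s * (t k * ‖e‖ ^ 2) ≤ inner ℝ (v' - v₂) e := by
        rcases ih with h0 | ih
        · refine ⟨v₂, ?_, ?_⟩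
          · simpa [l, h0] using h₂
          · simp [h0]
        · obtain ⟨v', hv'⟩ := hdom (t k) (t k).2
          exact ⟨v', hv', ih v' hv'⟩
      obtain ⟨a, ha⟩ := htc k
      have hstep := hs a a.2 hv (ha ⟨htm (Nat.le_succ k), le_rfl⟩) hv'
        (ha ⟨le_rfl, htm (Nat.le_succ k)⟩)
      set d := (t (k + 1) : ℝ) - t k with hd
      have hd0 : 0 < d := sub_pos.2 hlt
      have ed : l (t (k + 1)) - l (t k) = d • e := by
        simp only [l, hd, sub_smul]; abel
      rw [ed, norm_smul, mul_pow, Real.norm_of_nonneg hd0.le, real_inner_smul_right] at hstep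
      have h3 : -s * (d * ‖e‖ ^ 2) ≤ inner ℝ (v - v') e := by
        refine le_of_mul_le_mul_left ?_ hd0
        linarith
      have h4 : inner ℝ (v - v₂) e = inner ℝ (v - v') e + inner ℝ (v' - v₂) e := by
        rw [← inner_add_left, sub_add_sub_cancel]
      rw [h4, show (t (k + 1) : ℝ) = d + t k by rw [hd]; ring]
      linarith
  have hend := key n
  rw [hn n le_rfl] at hend
  rcases hend with h0 | h1
  · exact absurd h0 one_ne_zero
  · simpa using h1 v₁ (by simpa [l, he] using h₁)

theorem IsSemilocallyHypomonotone.isHypomonotone [CompleteSpace X] {T : X → Set X}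
    (hconv : Convex ℝ (dom T)) (hclosed : IsClosed (gph T)) {κ : ℝ} (hκ : 0 ≤ κ)
    (hT : HasCoderivativeBound T κ) (h : IsSemilocallyHypomonotone T) : IsHypomonotone T := by
  have h1 : IsHypomonotoneOn T Set.univ (-κ) := isHypomonotoneOn_univ_of_local hconv fun a ha => by
    obtain ⟨ρ, hρ, r, hr0, hr⟩ := isSemilocallyHypomonotone_iff.1 h a ha
    exact ⟨ρ / 64, by positivity, hr.neg_of_coderivativeBound hclosed hκ hT ha hρ hr0⟩
  refine isHypomonotone_iff.2 ⟨1, one_pos, fun u₁ v₁ u₂ v₂ h₁ h₁' h₂ h₂' => ?_⟩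
  have h2 := h1 h₁ h₁' h₂ h₂'
  have h3 : 0 ≤ ‖u₁ - u₂‖ ^ 2 := by positivity
  nlinarith

lemma IsMonotone.isHypomonotone {T : X → Set X} (h : IsMonotone T) : IsHypomonotone T :=
  ⟨1, one_pos, fun p hp q hq => by
    have h1 := h p hp q hq
    have h2 : 0 ≤ ‖p.1 - q.1‖ ^ 2 := by positivity
    linarith⟩

lemma IsHypomonotone.isSemilocallyHypomonotone {T : X → Set X} (h : IsHypomonotone T) :
    IsSemilocallyHypomonotone T := by
  obtain ⟨r, hr0, hr⟩ := h
  exact fun _ _ => ⟨_, univ_mem, r, hr0, fun p hp q hq => hr p hp.1 q hq.1⟩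

end Global

/-! ### Minty's theorem -/

section Minty

/-- Minimization of `s + ‖z‖² / 2` over a closed convex set of pairs `(z, s)`, such as the epigraph
of a convex function, with the first-order optimality condition. -/
lemma exists_minimizer_add_half_sq {E : Type*} [NormedAddCommGroup E] [InnerProductSpace ℝ E]
    [CompleteSpace E] {C : Set (E × ℝ)} (hne : C.Nonempty) (hC : IsClosed C) (hconv : Convex ℝ C)
    (hbdd : ∀ p ∈ C, 0 ≤ p.2 + ‖p.1‖ ^ 2 / 2) :
    ∃ p ∈ C, ∀ q ∈ C, p.2 - inner ℝ p.1 (q.1 - p.1) ≤ q.2 := by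
  let h : E × ℝ → ℝ := fun p => p.2 + ‖p.1‖ ^ 2 / 2
  have hb : BddBelow (h '' C) := ⟨0, by rintro _ ⟨p, hp, rfl⟩; exact hbdd p hp⟩
  set I := sInf (h '' C) with hI
  have hIle : ∀ p ∈ C, I ≤ h p := fun p hp => csInf_le hb ⟨p, hp, rfl⟩
  obtain ⟨ξ, -, hξ, hξC⟩ := exists_seq_tendsto_sInf (hne.image h) hb
  choose p hpC hpξ using hξC
  obtain rfl : (fun n => h (p n)) = ξ := funext hpξ
  -- Strong convexity: almost-minimizers are close to each other.
  have hmid : ∀ q ∈ C, ∀ q' ∈ C, ‖q.1 - q'.1‖ ^ 2 ≤ 4 * (h q - I) + 4 * (h q' - I) := by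
    intro q hq q' hq'
    have h1 := hIle _ (hconv hq hq' (by norm_num : (0 : ℝ) ≤ 1 / 2)
      (by norm_num : (0 : ℝ) ≤ 1 / 2) (by norm_num))
    have h2 := parallelogram_law_with_norm ℝ q.1 q'.1
    have h3 : ‖(1 / 2 : ℝ) • q.1 + (1 / 2 : ℝ) • q'.1‖ = 1 / 2 * ‖q.1 + q'.1‖ := by
      rw [← smul_add, norm_smul, Real.norm_of_nonneg (by norm_num)]
    simp only [h, Prod.fst_add, Prod.snd_add, Prod.smul_fst, Prod.smul_snd, smul_eq_mul, h3] at h1 ⊢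
    nlinarith
  have hcauchy : CauchySeq fun n => (p n).1 := by
    rw [Metric.cauchySeq_iff]
    intro ε hε
    have hev : ∀ᶠ n in atTop, h (p n) < I + ε ^ 2 / 8 :=
      hξ.eventually_lt_const (lt_add_of_pos_right _ (by positivity))
    obtain ⟨N, hN⟩ := eventually_atTop.1 hev
    refine ⟨N, fun m hm n hn => ?_⟩
    rw [dist_eq_norm]
    refine lt_of_pow_lt_pow_left₀ 2 hε.le ?_
    linarith [hmid _ (hpC m) _ (hpC n), hN m hm, hN n hn]
  obtain ⟨z, hz⟩ := cauchySeq_tendsto_of_complete hcauchy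
  have hs : Tendsto (fun n => (p n).2) atTop (𝓝 (I - ‖z‖ ^ 2 / 2)) := by
    have := hξ.sub ((hz.norm.pow 2).div_const 2)
    refine this.congr fun n => ?_
    simp only [h]; ring
  have hmem : (z, I - ‖z‖ ^ 2 / 2) ∈ C :=
    hC.mem_of_tendsto (hz.prodMk_nhds hs) (Eventually.of_forall hpC)
  refine ⟨_, hmem, fun q hq => ?_⟩
  set s := I - ‖z‖ ^ 2 / 2 with hsdef
  -- The derivative of the objective along the segment towards `q` is nonnegative.
  have hlim : Tendsto (fun t : ℝ => (q.2 - s) + inner ℝ z (q.1 - z) + t * (‖q.1 - z‖ ^ 2 / 2))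
      (𝓝[>] 0) (𝓝 ((q.2 - s) + inner ℝ z (q.1 - z) + 0 * (‖q.1 - z‖ ^ 2 / 2))) := by
    refine Tendsto.mono_left (Continuous.tendsto ?_ 0) nhdsWithin_le_nhds
    fun_prop
  have h0 := ge_of_tendsto (b := 0) hlim (by
    filter_upwards [Ioo_mem_nhdsGT one_pos] with t ht
    have h1 := hIle _ (hconv.add_smul_sub_mem hmem hq ⟨ht.1.le, ht.2.le⟩)
    simp only [h, Prod.fst_add, Prod.snd_add, Prod.smul_fst, Prod.smul_snd, smul_eq_mul,
      Prod.fst_sub, Prod.snd_sub, norm_add_sq_real, real_inner_smul_right, norm_smul, mul_pow,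
      Real.norm_of_nonneg ht.1.le] at h1
    refine le_of_mul_le_mul_left ?_ ht.1
    linarith)
  linarith

variable {X : Type*} [NormedAddCommGroup X] [InnerProductSpace ℝ X]

lemma IsMaximalMonotone.mem_of_forall {T : X → Set X} (hT : IsMaximalMonotone T) {a b : X}
    (h : ∀ u, ∀ v ∈ T u, 0 ≤ inner ℝ (b - v) (a - u)) : b ∈ T a := by
  let S : X → Set X := fun u => {v | v ∈ T u ∨ (u = a ∧ v = b)}
  have hS : IsMonotone S := by
    rintro ⟨u₁, v₁⟩ (h₁ | ⟨h₁, h₁'⟩) ⟨u₂, v₂⟩ (h₂ | ⟨h₂, h₂'⟩)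
    · exact hT.1 (u₁, v₁) h₁ (u₂, v₂) h₂
    · simp only at h₂ h₂'
      subst h₂ h₂'
      have := h u₁ v₁ h₁
      rwa [← inner_neg_neg, neg_sub, neg_sub] at this
    · simp only at h₁ h₁'
      subst h₁ h₁'
      exact h u₂ v₂ h₂
    · simp only at h₁ h₁' h₂ h₂'
      subst h₁ h₁' h₂ h₂'
      simp
  have hsub : gph T ⊆ gph S := fun p hp => Or.inl hp
  have : (a, b) ∈ gph S := Or.inr ⟨rfl, rfl⟩
  rwa [← hT.2 S hS hsub] at this

/-- Minty's theorem at the point `0`, for a nonempty monotone graph to which no pair can be added.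
Adding `(‖a‖² + ‖b‖²) / 2` to the Fitzpatrick function
`F (a, b) = sup {⟪a, v⟫ + ⟪u, b⟫ - ⟪u, v⟫ | v ∈ T u}` gives a function with a minimizer. Since
`F ≥ ⟪·, ·⟫`, the optimality condition at the minimizer `(a, b)`, tested on the graph, says that
`(-b, -a)` is monotonically related to the graph, and then that `a = -b`. -/
lemma exists_add_eq_zero [CompleteSpace X] {T : X → Set X} (hne : (gph T).Nonempty)
    (hmono : IsMonotone T)
    (hmax : ∀ a b : X, (∀ u, ∀ v ∈ T u, 0 ≤ inner ℝ (b - v) (a - u)) → b ∈ T a) :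
    ∃ u, ∃ v ∈ T u, u + v = 0 := by
  let C : Set (WithLp 2 (X × X) × ℝ) := {p | ∀ u, ∀ v ∈ T u,
    inner ℝ p.1.ofLp.1 v + inner ℝ u p.1.ofLp.2 - inner ℝ u v ≤ p.2}
  have hgC : ∀ u, ∀ v ∈ T u, (WithLp.toLp 2 (u, v), inner ℝ u v) ∈ C := by
    intro u v hv u' v' hv'
    have h1 : 0 ≤ inner ℝ (v - v') (u - u') := hmono (u, v) hv (u', v') hv'
    rw [real_inner_comm, inner_sub_left, inner_sub_right, inner_sub_right] at h1
    change inner ℝ u v' + inner ℝ u' v - inner ℝ u' v' ≤ inner ℝ u v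
    linarith
  have hinner : ∀ p ∈ C, inner ℝ p.1.ofLp.1 p.1.ofLp.2 ≤ p.2 := by
    rintro ⟨z, s⟩ hp
    set a := z.ofLp.1 with ha
    set b := z.ofLp.2 with hb
    change inner ℝ a b ≤ s
    have hp' : ∀ u, ∀ v ∈ T u, inner ℝ a v + inner ℝ u b - inner ℝ u v ≤ s := hp
    by_contra! hlt
    have hab : b ∈ T a := hmax a b fun u v hv => by
      have := hp' u v hv
      rw [real_inner_comm, inner_sub_left, inner_sub_right, inner_sub_right]
      linarith
    linarith [hp' a b hab]
  obtain ⟨⟨u₀, v₀⟩, h₀⟩ := hne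
  have hclosed : IsClosed C := by
    have hc1 : Continuous fun p : WithLp 2 (X × X) × ℝ => p.1.ofLp.1 :=
      continuous_fst.comp ((WithLp.prod_continuous_ofLp 2 X X).comp continuous_fst)
    have hc2 : Continuous fun p : WithLp 2 (X × X) × ℝ => p.1.ofLp.2 :=
      continuous_snd.comp ((WithLp.prod_continuous_ofLp 2 X X).comp continuous_fst)
    simp only [C, Set.ofPred_forall]
    refine isClosed_iInter fun u => isClosed_iInter fun v => isClosed_iInter fun _ => ?_
    exact isClosed_le (((hc1.inner continuous_const).add (continuous_const.inner hc2)).sub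
      continuous_const) continuous_snd
  have hconv : Convex ℝ C := by
    intro p hp q hq s t hs ht hst u v hv
    have h1 := mul_le_mul_of_nonneg_left (hp u v hv) hs
    have h2 := mul_le_mul_of_nonneg_left (hq u v hv) ht
    change inner ℝ (s • p.1.ofLp.1 + t • q.1.ofLp.1) v +
      inner ℝ u (s • p.1.ofLp.2 + t • q.1.ofLp.2) - inner ℝ u v ≤ s * p.2 + t * q.2
    simp only [inner_add_left, inner_add_right, real_inner_smul_left, real_inner_smul_right]
    have e : inner ℝ u v = s * inner ℝ u v + t * inner ℝ u v := by rw [← add_mul, hst, one_mul]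
    rw [e]
    linarith
  have hnormsq : ∀ z : WithLp 2 (X × X), ‖z‖ ^ 2 = ‖z.ofLp.1‖ ^ 2 + ‖z.ofLp.2‖ ^ 2 :=
    WithLp.prod_norm_sq_eq_of_L2
  obtain ⟨⟨z, s⟩, hzC, hopt⟩ := exists_minimizer_add_half_sq ⟨_, hgC u₀ v₀ h₀⟩ hclosed hconv
    fun p hp => by
      have h1 := hinner p hp
      have h2 := norm_add_sq_real p.1.ofLp.1 p.1.ofLp.2
      have h3 : 0 ≤ ‖p.1.ofLp.1 + p.1.ofLp.2‖ ^ 2 := by positivity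
      rw [hnormsq]
      linarith
  set a := z.ofLp.1 with ha
  set b := z.ofLp.2 with hb
  have hab : inner ℝ a b ≤ s := hinner _ hzC
  have hnorm := norm_add_sq_real a b
  have key : ∀ u, ∀ v ∈ T u, ‖a + b‖ ^ 2 ≤ inner ℝ (-a - v) (-b - u) := by
    intro u v hv
    have h1 := hopt _ (hgC u v hv)
    rw [WithLp.prod_inner_apply] at h1
    change s - (inner ℝ a (u - a) + inner ℝ b (v - b)) ≤ inner ℝ u v at h1
    simp only [inner_sub_left, inner_sub_right, inner_neg_left, inner_neg_right,
      real_inner_self_eq_norm_sq] at h1 ⊢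
    linarith [real_inner_comm b v, real_inner_comm u v]
  have hmem : -a ∈ T (-b) := hmax (-b) (-a) fun u v hv => le_trans (by positivity) (key u v hv)
  have h0 := key _ _ hmem
  rw [sub_self, inner_zero_left] at h0
  have h1 : a + b = 0 := norm_eq_zero.1 (pow_eq_zero_iff two_ne_zero |>.1
    (le_antisymm h0 (by positivity)))
  exact ⟨-b, -a, hmem, by rw [← neg_add, add_comm, h1, neg_zero]⟩

/-- Minty's theorem: `I + T` is onto if `T` is maximal monotone. -/
theorem IsMaximalMonotone.exists_add_eq [CompleteSpace X] {T : X → Set X}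
    (hT : IsMaximalMonotone T) (hne : (dom T).Nonempty) (y : X) : ∃ u, ∃ v ∈ T u, u + v = y := by
  obtain ⟨u₀, v₀, h₀⟩ := hne
  obtain ⟨u, v, hv, huv⟩ := exists_add_eq_zero (T := fun u => {v | v + y ∈ T u})
    ⟨(u₀, v₀ - y), by simpa [gph] using h₀⟩
    (fun p hp q hq => by simpa using hT.1 (p.1, p.2 + y) hp (q.1, q.2 + y) hq)
    (fun a b h => hT.mem_of_forall fun u v hv => by
      have := h u (v - y) (by simpa using hv)
      rwa [sub_sub_eq_add_sub] at this)
  exact ⟨u, v + y, hv, by rw [← add_assoc, huv, zero_add]⟩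

end Minty

/-! ### Necessity of the coderivative bound, and limiting coderivatives -/

section Necessity

variable {X : Type*} [NormedAddCommGroup X] [InnerProductSpace ℝ X]

/-- Strong maximal monotonicity forces the coderivative bound: the resolvent `(I + T)⁻¹` is defined
everywhere, so the defining inequality of `z ∈ D̂*T(u, v)(w)` can be tested at the graph point
with `u' + v' = u + v + t h`, for every direction `h`. -/
theorem IsStronglyMaximalMonotone.hasCoderivativeBound [CompleteSpace X] {T : X → Set X} {κ : ℝ}
    (hκ : 0 ≤ κ) (hT : IsStronglyMaximalMonotone κ T) : HasCoderivativeBound T κ := by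
  have hmono := isMonotone_addSmulId_iff.1 hT.2
  intro u v hv w z hz
  have hsurj := hT.1.exists_add_eq ⟨u, v, hv⟩
  set m := 1 + κ with hm
  have hm0 : 0 < m := by positivity
  set γ := (2 * m)⁻¹ with hγ
  have hγ0 : 0 < γ := by positivity
  have hγ1 : 2 * γ ≤ 1 := by
    rw [hγ, mul_inv, mul_inv_cancel_left₀ two_ne_zero]
    exact inv_le_one_of_one_le₀ (by linarith)
  set p := z + w with hp
  suffices hmain : ‖w - γ • p‖ ≤ γ * ‖p‖ by
    have h1 := (norm_sub_smul_le_iff hm0).1 hmain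
    rw [hp, inner_add_left, real_inner_self_eq_norm_sq, hm] at h1
    linarith
  set h := γ • p - w with hh
  rw [norm_sub_rev, ← hh]
  refine le_of_forall_pos_le_add fun ε hε => ?_
  obtain ⟨δ, hδ, hball⟩ := Metric.mem_nhdsWithin_iff.1 (hz.2 (ε / 3) (by positivity))
  obtain ⟨t, ht, htδ⟩ : ∃ t : ℝ, 0 < t ∧ 3 * (t * ‖h‖) < δ := by
    refine ⟨δ / (3 * ‖h‖ + 1), by positivity, ?_⟩
    rw [← mul_assoc, mul_comm (3 : ℝ), mul_assoc, div_mul_eq_mul_div, div_lt_iff₀ (by positivity)]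
    linarith
  obtain ⟨u', v', hv', huv⟩ := hsurj (u + v + t • h)
  set d := u' - u with hd
  have ev : v' - v = t • h - d := by
    rw [hd, sub_eq_iff_eq_add, sub_sub_eq_add_sub, sub_add_eq_add_sub, eq_sub_iff_add_eq,
      add_comm v', huv]
    abel
  have hth : ‖t • h‖ = t * ‖h‖ := by rw [norm_smul, Real.norm_of_nonneg ht.le]
  have hdball : ‖d - γ • (t • h)‖ ≤ γ * ‖t • h‖ := by
    refine (norm_sub_smul_le_iff hm0).2 ?_
    have h1 := hmono hv' trivial hv trivial
    rw [ev, ← hd, inner_sub_left, real_inner_self_eq_norm_sq] at h1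
    rw [hm]
    linarith
  have hdn : ‖d‖ ≤ t * ‖h‖ := by
    have h1 := norm_sub_norm_le d (γ • (t • h))
    rw [norm_smul γ, Real.norm_of_nonneg hγ0.le] at h1
    have h2 : 2 * γ * ‖t • h‖ ≤ 1 * ‖t • h‖ := by gcongr
    rw [← hth]
    linarith
  set y : WithLp 2 (X × X) := WithLp.toLp 2 (u', v') - WithLp.toLp 2 (u, v) with hy
  have hyn : ‖y‖ ≤ 3 * (t * ‖h‖) := by
    have h1 : ‖y‖ ^ 2 = ‖d‖ ^ 2 + ‖v' - v‖ ^ 2 := WithLp.prod_norm_sq_eq_of_L2 y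
    have h2 : ‖v' - v‖ ≤ 2 * (t * ‖h‖) := by
      rw [ev]
      linarith [_root_.norm_sub_le (t • h) d]
    refine le_of_sq_le_sq ?_ (by positivity)
    have h3 : ‖d‖ ^ 2 ≤ (t * ‖h‖) ^ 2 := by gcongr
    have h4 : ‖v' - v‖ ^ 2 ≤ (2 * (t * ‖h‖)) ^ 2 := by gcongr
    rw [h1]
    nlinarith [sq_nonneg (t * ‖h‖)]
  have htest : inner ℝ (WithLp.toLp 2 (z, -w)) y ≤ ε / 3 * ‖y‖ :=
    hball (a := WithLp.toLp 2 (u', v')) ⟨by rw [mem_ball_iff_norm, ← hy]; linarith, hv'⟩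
  rw [WithLp.prod_inner_apply] at htest
  change inner ℝ z d + inner ℝ (-w) (v' - v) ≤ ε / 3 * ‖y‖ at htest
  have h1 : ε / 3 * ‖y‖ ≤ ε / 3 * (3 * (t * ‖h‖)) := by gcongr
  have h2 : inner ℝ p d - t * inner ℝ w h ≤ t * (ε * ‖h‖) := by
    rw [ev, inner_neg_left, inner_sub_right w, real_inner_smul_right] at htest
    rw [hp, inner_add_left]
    linarith
  have h3 : γ * (t * inner ℝ p h) - t * (γ * ‖p‖ * ‖h‖) ≤ inner ℝ p d := by
    have h4 := (abs_le.1 (abs_real_inner_le_norm p (d - γ • (t • h)))).1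
    have h5 : ‖p‖ * ‖d - γ • (t • h)‖ ≤ ‖p‖ * (γ * ‖t • h‖) := by gcongr
    rw [inner_sub_right, real_inner_smul_right, real_inner_smul_right] at h4
    rw [hth] at h5
    linarith
  have h4 : ‖h‖ * ‖h‖ = γ * inner ℝ p h - inner ℝ w h := by
    rw [← real_inner_self_eq_norm_mul_norm]
    nth_rw 1 [hh]
    rw [inner_sub_left, real_inner_smul_left]
  have h5 : ‖h‖ * ‖h‖ ≤ (γ * ‖p‖ + ε) * ‖h‖ := by
    refine le_of_mul_le_mul_left ?_ ht
    rw [h4]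
    linarith
  rcases (norm_nonneg h).eq_or_lt' with h0 | h0
  · rw [h0]; positivity
  · exact le_of_mul_le_mul_right h5 h0

lemma regularCoderivative_subset_mixedCoderivative (T : X → Set X) (u v w : X) :
    regularCoderivative T u v w ⊆ mixedCoderivative T u v w :=
  fun z hz => ⟨fun _ => u, fun _ => v, fun _ => w, fun _ => z, tendsto_const_nhds,
    tendsto_const_nhds, tendsto_const_nhds, fun _ => tendsto_const_nhds, fun _ => hz⟩

/-- The pairing of a weakly convergent sequence with a strongly convergent one converges, since
weakly convergent sequences are bounded. -/
lemma tendsto_inner_of_weak [CompleteSpace X] {ζ y : ℕ → X} {z w : X}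
    (hζ : ∀ h : X, Tendsto (fun k => inner ℝ (ζ k) h) atTop (𝓝 (inner ℝ z h)))
    (hy : Tendsto y atTop (𝓝 w)) :
    Tendsto (fun k => inner ℝ (ζ k) (y k)) atTop (𝓝 (inner ℝ z w)) := by
  obtain ⟨B, hB⟩ := banach_steinhaus (g := fun k => innerSL ℝ (ζ k)) fun h => by
    obtain ⟨B, hB⟩ := (hζ h).norm.bddAbove_range
    exact ⟨B, fun k => hB ⟨k, rfl⟩⟩
  have h1 : Tendsto (fun k => inner ℝ (ζ k) (y k - w)) atTop (𝓝 0) := by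
    refine squeeze_zero_norm (a := fun k => B * ‖y k - w‖) (fun k => ?_) ?_
    · have h2 := hB k
      rw [innerSL_apply_norm] at h2
      exact (norm_inner_le_norm _ _).trans (by gcongr)
    · simpa using (tendsto_iff_norm_sub_tendsto_zero.1 hy).const_mul B
  simpa [inner_sub_right] using h1.add (hζ w)

lemma hasCoderivativeBound_iff_mixed [CompleteSpace X] {T : X → Set X} {κ : ℝ} :
    HasCoderivativeBound T κ ↔ ∀ u v : X, (u, v) ∈ gph T →
      ∀ w z : X, z ∈ mixedCoderivative T u v w → κ * ‖w‖ ^ 2 ≤ inner ℝ z w := by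
  refine ⟨?_, fun h u v hv w z hz =>
    h u v hv w z (regularCoderivative_subset_mixedCoderivative T u v w hz)⟩
  rintro h u v - w z ⟨a, b, y, ζ, -, -, hy, hζ, hmem⟩
  exact le_of_tendsto_of_tendsto' ((hy.norm.pow 2).const_mul κ) (tendsto_inner_of_weak hζ hy)
    fun k => h (hmem k).1 (hmem k)

end Necessity

end SetValued

theorem corollary3p10 {X : Type*} [NormedAddCommGroup X] [InnerProductSpace ℝ X]
    [CompleteSpace X] (T : X → Set X) (hproper : (SetValued.dom T).Nonempty)
    (hclosed : IsClosed (SetValued.gph T)) (κ : ℝ) (hκ : 0 < κ) :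
    List.TFAE
      [SetValued.IsStronglyMaximalMonotone κ T,
       SetValued.IsHypomonotone T ∧ ∀ u v : X, (u, v) ∈ SetValued.gph T →
         ∀ w z : X, z ∈ SetValued.regularCoderivative T u v w → κ * ‖w‖ ^ 2 ≤ inner ℝ z w,
       SetValued.IsHypomonotone T ∧ ∀ u v : X, (u, v) ∈ SetValued.gph T →
         ∀ w z : X, z ∈ SetValued.mixedCoderivative T u v w → κ * ‖w‖ ^ 2 ≤ inner ℝ z w] ∧
    (Convex ℝ (SetValued.dom T) →
      List.TFAE
        [SetValued.IsStronglyMaximalMonotone κ T,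
         SetValued.IsSemilocallyHypomonotone T ∧ ∀ u v : X, (u, v) ∈ SetValued.gph T →
           ∀ w z : X, z ∈ SetValued.regularCoderivative T u v w → κ * ‖w‖ ^ 2 ≤ inner ℝ z w,
         SetValued.IsSemilocallyHypomonotone T ∧ ∀ u v : X, (u, v) ∈ SetValued.gph T →
           ∀ w z : X, z ∈ SetValued.mixedCoderivative T u v w →
             κ * ‖w‖ ^ 2 ≤ inner ℝ z w]) := by
  have hmixed := SetValued.hasCoderivativeBound_iff_mixed (T := T) (κ := κ)
  refine ⟨?_, fun hconv => ?_⟩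
  · tfae_have 1 → 2 := fun h =>
      ⟨h.1.1.isHypomonotone, fun _ _ hv _ _ hz => h.hasCoderivativeBound hκ.le hv hz⟩
    tfae_have 2 → 3 := fun h => ⟨h.1, hmixed.1 fun u v hv w z hz => h.2 u v hv w z hz⟩
    tfae_have 3 → 1 := fun h =>
      h.1.isStronglyMaximalMonotone hproper hclosed hκ.le (hmixed.2 h.2)
    tfae_finish
  · tfae_have 1 → 2 := fun h =>
      ⟨h.1.1.isHypomonotone.isSemilocallyHypomonotone,
        fun _ _ hv _ _ hz => h.hasCoderivativeBound hκ.le hv hz⟩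
    tfae_have 2 → 3 := fun h => ⟨h.1, hmixed.1 fun u v hv w z hz => h.2 u v hv w z hz⟩
    tfae_have 3 → 1 := fun h =>
      (h.1.isHypomonotone hconv hclosed hκ.le (hmixed.2 h.2)).isStronglyMaximalMonotone
        hproper hclosed hκ.le (hmixed.2 h.2)
    tfae_finish
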